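/- Let $x\in\mathbb{R}^d$, $x\neq 0$, $y\in\mathbb{R}$, and let $\sigma$ be either $\tanh$ or the logistic function $\sigma(u)=1/(1+e^{-u})$. For $\theta=(c,w)$ with $c\in\mathbb{R}^n$ and $w=(w_1,\dots,w_n)$, $w_i\in\mathbb{R}^d$ (any width $n$), let $$f_\theta(x)=\sum_{i=1}^n c_i\,\sigma(w_i^\top x).$$ Let $Z_0,Z_1,\dots$ be independent, uniformly bounded real random variables with mean $0$ and variance $1$ (the label noise). For a learning rate $\eta>0$ and an initialization $\theta(0)$, SGD with label noise on the single training point $(x,y)$ is $$\theta(t+1)=\theta(t)-\eta\,\nabla_\theta\big(f_\theta(x)-(y+Z_t)\big)^2\Big|_{\theta=\theta(t)} .$$ Call $\theta^*$ *non-repellent* if there is $p>0$ such that for all sufficiently small $\eta>0$ and every $\theta(0)$ with $\|\theta(0)-\theta^*\|\le\eta^{0.5}$, with probability at least $1-\exp(-\eta^{-p})$ one has $\|\theta(t)-\theta^*\|\le\eta^{0.44}$ for all integers $0\le t\le\eta^{-1.6}$. **Theorem.** If $\theta=(c,w)$ is non-repellent, then there exist real numbers $\alpha_1,\beta_1,\alpha_2,\beta_2$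 such that for every hidden unit $i$, either $(c_i,\sigma(w_i^\top x))=(\alpha_1,\beta_1)$, or $(c_i,\sigma(w_i^\top x))=(\alpha_2,\beta_2)$, or $c_i=\sigma(w_i^\top x)=0$. If $\sigma=\tanh$, one can moreover take $\alpha_2=-\alpha_1$ and $\beta_2=-\beta_1$. -/

import Mathlib

open MeasureTheory ProbabilityTheory Filter Topology

namespace LabelNoiseSGD

section Dynamics

variable {Θ : Type*} [NormedAddCommGroup Θ] [InnerProductSpace ℝ Θ] [CompleteSpace Θ]

/-- One step of SGD with learning rate `η` for the squared loss on a single training point with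
label `y`, where `F θ` is the prediction of the model with parameters `θ` at that point and `z` is
the label noise of this step: `θ ↦ θ - η ∇_θ (F θ - (y + z))²`. -/
noncomputable def sgdStep (F : Θ → ℝ) (y η z : ℝ) (θ : Θ) : Θ :=
  θ - η • gradient (fun θ' : Θ => (F θ' - (y + z)) ^ 2) θ

/-- The parameters `θ(t)` after `t` steps of SGD started at `θ₀`, when the label noise used in the
step from time `t` to time `t + 1` is `z t`. -/
noncomputable def sgdPath (F : Θ → ℝ) (y η : ℝ) (z : ℕ → ℝ) (θ₀ : Θ) : ℕ → Θ
  | 0 => θ₀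
  | t + 1 => sgdStep F y η (z t) (sgdPath F y η z θ₀ t)

/-- Independent, uniformly bounded label noise with mean zero and unit variance. -/
structure IsLabelNoise {Ω : Type*} [MeasurableSpace Ω] (μ : Measure Ω) (Z : ℕ → Ω → ℝ) : Prop where
  measurable : ∀ t, Measurable (Z t)
  indep : iIndepFun Z μ
  mean_zero : ∀ t, ∫ ω, Z t ω ∂μ = 0
  unit_variance : ∀ t, variance (Z t) μ = 1
  bounded : ∃ B : ℝ, ∀ t, ∀ᵐ ω ∂μ, |Z t ω| ≤ B

/-- `θs` is non-repellent for SGD with label noise `Z`: for every sufficiently small learning rate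
`η > 0` and every initialization `θ₀` with `‖θ₀ - θs‖ ≤ η ^ 0.5`, with probability at least
`1 - exp (-1 / poly(η))` all iterates `θ(t)` with `t ≤ η ^ (-1.6)` satisfy
`‖θ(t) - θs‖ ≤ η ^ 0.44`. Here `poly(η)` is `η ^ p` for some exponent `p > 0` which does not
depend on `η` or `θ₀` (a constant factor in front is absorbed by a smaller exponent). -/
def NonRepellent {Ω : Type*} [MeasurableSpace Ω] (μ : Measure Ω) (Z : ℕ → Ω → ℝ)
    (F : Θ → ℝ) (y : ℝ) (θs : Θ) : Prop :=
  ∃ p : ℝ, 0 < p ∧ ∀ᶠ η : ℝ in 𝓝[>] 0, ∀ θ₀ : Θ, ‖θ₀ - θs‖ ≤ η ^ (0.5 : ℝ) →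
    1 - Real.exp (-(1 / η ^ p)) ≤
      μ.real {ω | ∀ t : ℕ, (t : ℝ) ≤ η ^ (-1.6 : ℝ) →
        ‖sgdPath F y η (fun s => Z s ω) θ₀ t - θs‖ ≤ η ^ (0.44 : ℝ)}

end Dynamics

/-- All trainable parameters of a two-layer network with `n` hidden units and input dimension `d`,
with the Euclidean norm: the output weights `c i` are the coordinates `Sum.inl i`, and the hidden
weights `w i j` are the coordinates `Sum.inr (i, j)`. -/
abbrev Params (n d : ℕ) : Type := EuclideanSpace ℝ (Fin n ⊕ Fin n × Fin d)

/-- The output weight `c i`. -/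
def Params.c {n d : ℕ} (θ : Params n d) (i : Fin n) : ℝ := θ (Sum.inl i)

/-- The hidden weight vector `w i`. -/
def Params.w {n d : ℕ} (θ : Params n d) (i : Fin n) : EuclideanSpace ℝ (Fin d) :=
  WithLp.toLp 2 fun j => θ (Sum.inr (i, j))

/-- The value `σ (wᵢᵀ x)` of the `i`-th hidden unit at the input `x`. -/
noncomputable def hidden {n d : ℕ} (σ : ℝ → ℝ) (x : EuclideanSpace ℝ (Fin d)) (θ : Params n d)
    (i : Fin n) : ℝ :=
  σ (inner ℝ (Params.w θ i) x)

/-- The prediction `f_θ(x) = ∑ i, c i * σ (wᵢᵀ x)` of the two-layer network. -/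
noncomputable def network {n d : ℕ} (σ : ℝ → ℝ) (x : EuclideanSpace ℝ (Fin d)) (θ : Params n d) :
    ℝ :=
  ∑ i, Params.c θ i * hidden σ x θ i

end LabelNoiseSGD

namespace LabelNoiseSGD

/-! ### Approximate invariants of the gradient flow of `F` and their convexity along it. -/

section Geometry

open scoped ContDiff

variable {E : Type*} [NormedAddCommGroup E] [InnerProductSpace ℝ E] [CompleteSpace E]

/-! Every SGD step moves `θ` along `∇F(θ)` by a coefficient `a = 2η(z - (F θ - y))` of random sign.
Gradient flow run back and forth would retrace one curve, but discrete steps drift off it at second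
order, in the direction `-D(∇F)·∇F`. If the part `v` of this vector orthogonal to `∇F` is nonzero at
`x₀`, the drift pushes the iterates away.

To detect it, `exists_approx_invariant` builds a function `φ` with differential `v` at `x₀` that is
constant along gradient flow up to an error of order `(F - F x₀)^3`. Then `φ` is strictly convex in
the direction `∇F`, with second derivative `‖v‖²` at `x₀`, so a step raises `φ` by at least `κ a²`
up to a negligible error (`exists_local_control`). The mean gain per step is of order `η²`, hence of
order `η^0.4` over `η^(-1.6)` steps. On a ball of radius comparable to `η^0.44`, however, `φ` varies
by only `O(η^0.44)`, which is smaller. This contradiction is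
`NonRepellent.exists_fderiv_gradient_eq`: at a non-repellent point `D(∇F)·∇F = l ∇F`.

For the network this equation splits into two scalar equations per hidden unit, coupled only through
the common `l` (`stationarity_of_fderiv_gradient_eq`). Eliminating `c` leaves one equation in `b =
σ(wᵀx)`. For `tanh` it determines `b²`; for the logistic function it reads `b(1-b)³ = const`, which
has at most two roots below 1. In each case `b` and `l` determine `c`. -/

theorem contDiff_gradient {F : E → ℝ} (hF : ContDiff ℝ ∞ F) : ContDiff ℝ ∞ (gradient F) :=
  (InnerProductSpace.toDual ℝ E).symm.contDiff.comp (hF.fderiv_right (m := ∞) le_rfl)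

theorem fderiv_apply_gradient (F : E → ℝ) (x u : E) :
    fderiv ℝ F x u = inner ℝ (gradient F x) u := by
  rw [gradient, InnerProductSpace.toDual_symm_apply]

theorem eventually_differentiableAt {E V : Type*} [NormedAddCommGroup E] [NormedSpace ℝ E]
    [NormedAddCommGroup V] [NormedSpace ℝ V] {φ : E → V} {x₀ : E} (h : ContDiffAt ℝ ∞ φ x₀) :
    ∀ᶠ x in 𝓝 x₀, DifferentiableAt ℝ φ x := by
  have h1 : ContDiffAt ℝ 1 φ x₀ := h.of_le (by exact_mod_cast le_top)
  filter_upwards [h1.eventually (by simp)] with x hx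
  exact hx.differentiableAt (by simp)

/-- Along the gradient flow of `F` there are functions with a prescribed differential at `x₀`
(vanishing on the flow direction) that are conserved up to any order. -/
theorem exists_approx_invariant {F : E → ℝ} (hF : ContDiff ℝ ∞ F) {x₀ v : E}
    (hg : gradient F x₀ ≠ 0) (hv : inner ℝ v (gradient F x₀) = 0) (k : ℕ) :
    ∃ φ h : E → ℝ, ContDiffAt ℝ ∞ φ x₀ ∧ ContDiffAt ℝ ∞ h x₀ ∧
      (∀ᶠ x in 𝓝 x₀, fderiv ℝ φ x (gradient F x) = (F x - F x₀) ^ k * h x) ∧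
      ∀ u, fderiv ℝ φ x₀ u = inner ℝ v u := by
  have hG := contDiff_gradient hF
  induction k with
  | zero =>
    refine ⟨fun x => inner ℝ v x, fun x => inner ℝ v (gradient F x), ?_, ?_, ?_, ?_⟩
    · exact (innerSL ℝ v).contDiff.contDiffAt
    · exact ((innerSL ℝ v).contDiff.comp hG).contDiffAt
    · refine Eventually.of_forall fun x => ?_
      have := (innerSL ℝ v).hasFDerivAt (x := x)
      rw [show (fun x => inner ℝ v x) = ⇑(innerSL ℝ v) from rfl, this.fderiv]
      simp
    · intro u
      have := (innerSL ℝ v).hasFDerivAt (x := x₀)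
      rw [show (fun x => inner ℝ v x) = ⇑(innerSL ℝ v) from rfl, this.fderiv]
      simp
  | succ k ih =>
    obtain ⟨φ, h, hφ, hh, hev, hd⟩ := ih
    have hρ : ContDiff ℝ ∞ fun x => ‖gradient F x‖ ^ 2 := hG.norm_sq ℝ
    -- Along its own gradient `F` grows at rate `‖∇F‖²`. With this `q`, subtracting `(F - F
    -- x₀)^(k+1) q / (k+1)` therefore cancels the defect `(F - F x₀)^k h` and leaves one of the next
    -- order.
    set q : E → ℝ := fun x => h x / ‖gradient F x‖ ^ 2 with hq_def
    have hq : ContDiffAt ℝ ∞ q x₀ := hh.div hρ.contDiffAt (by simpa using hg)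
    have key : ∀ x, DifferentiableAt ℝ φ x → DifferentiableAt ℝ q x → ∀ u,
        fderiv ℝ (fun x => φ x - (k + 1 : ℝ)⁻¹ * ((F x - F x₀) ^ (k + 1) * q x)) x u =
          fderiv ℝ φ x u - ((F x - F x₀) ^ k * q x * fderiv ℝ F x u +
            (k + 1 : ℝ)⁻¹ * ((F x - F x₀) ^ (k + 1) * fderiv ℝ q x u)) := by
      intro x h1 h2 u
      have hFx : HasFDerivAt F (fderiv ℝ F x) x :=
        (hF.differentiable (by simp)).differentiableAt.hasFDerivAt
      have hsub := h1.hasFDerivAt.sub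
        ((((hFx.sub_const (F x₀)).pow (k + 1)).mul h2.hasFDerivAt).const_mul (k + 1 : ℝ)⁻¹)
      rw [(show HasFDerivAt (fun x => φ x - (k + 1 : ℝ)⁻¹ * ((F x - F x₀) ^ (k + 1) * q x)) _ x
        from hsub).fderiv]
      have hk : (k + 1 : ℝ) ≠ 0 := by positivity
      simp
      field_simp
      ring
    refine ⟨fun x => φ x - (k + 1 : ℝ)⁻¹ * ((F x - F x₀) ^ (k + 1) * q x),
      fun x => - ((k + 1 : ℝ)⁻¹ * fderiv ℝ q x (gradient F x)), ?_, ?_, ?_, ?_⟩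
    · exact hφ.sub (contDiffAt_const.mul (((hF.contDiffAt.sub contDiffAt_const).pow _).mul hq))
    · exact (contDiffAt_const.mul
        ((hq.fderiv_right (m := ∞) le_rfl).clm_apply hG.contDiffAt)).neg
    · have hne : ∀ᶠ x in 𝓝 x₀, gradient F x ≠ 0 :=
        hG.continuous.continuousAt.eventually_ne hg
      filter_upwards [hev, eventually_differentiableAt hφ, eventually_differentiableAt hq, hne]
        with x h1 h2 h3 h4
      have h5 : ‖gradient F x‖ ^ 2 ≠ 0 := by simpa using h4
      rw [key x h2 h3, h1, fderiv_apply_gradient F, real_inner_self_eq_norm_sq, hq_def]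
      simp only
      field_simp
      ring
    · intro u
      -- The correction could change the differential at `x₀` only for `k = 0`, and there `q x₀ = 0`
      -- because `v` is orthogonal to the gradient. Evaluating the induction hypothesis at `x₀`
      -- covers all `k` at once.
      have h0 : (F x₀ - F x₀) ^ k * q x₀ = 0 := by
        have := hev.self_of_nhds
        rw [hd, hv] at this
        rw [hq_def]
        simp only
        rw [← mul_div_assoc, ← this, zero_div]
      rw [key x₀ (hφ.differentiableAt (by simp)) (hq.differentiableAt (by simp)), hd, h0]
      simp

/-- Differentiate the invariance identity at `x₀` along `∇F`. The right side vanishes there to order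
at least two and contributes nothing; the product rule on the left gives the two terms. -/
theorem second_fderiv_of_approx_invariant {F φ h : E → ℝ} (hF : ContDiff ℝ ∞ F) {x₀ v : E} {k : ℕ}
    (hφ : ContDiffAt ℝ ∞ φ x₀) (hh : ContDiffAt ℝ ∞ h x₀)
    (hev : ∀ᶠ x in 𝓝 x₀, fderiv ℝ φ x (gradient F x) = (F x - F x₀) ^ (k + 2) * h x)
    (hd : ∀ u, fderiv ℝ φ x₀ u = inner ℝ v u) :
    fderiv ℝ (fderiv ℝ φ) x₀ (gradient F x₀) (gradient F x₀) =
      - inner ℝ v (fderiv ℝ (gradient F) x₀ (gradient F x₀)) := by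
  have hG := contDiff_gradient hF
  have hFx : HasFDerivAt F (fderiv ℝ F x₀) x₀ :=
    (hF.differentiable (by simp)).differentiableAt.hasFDerivAt
  have h1 := (((hφ.fderiv_right (m := ∞) le_rfl).differentiableAt (by simp)).hasFDerivAt).clm_apply
    ((hG.differentiable (by simp)).differentiableAt (x := x₀)).hasFDerivAt
  have h2 := (((hFx.sub_const (F x₀)).pow (k + 2)).mul
    (hh.differentiableAt (by simp)).hasFDerivAt)
  have h3 := h1.unique (h2.congr_of_eventuallyEq (hev.mono fun x hx => by simpa using hx))
  have h4 := congrArg (fun A : E →L[ℝ] ℝ => A (gradient F x₀)) h3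
  simp [hd] at h4
  linarith

/-- `q - κ b²` is convex on the interval, so it lies above its tangent at 0. -/
theorem quadratic_lower_bound_of_second_deriv {q q' q'' : ℝ → ℝ} {κ r : ℝ}
    (d1 : ∀ b, |b| ≤ r → HasDerivAt q (q' b) b) (d2 : ∀ b, |b| ≤ r → HasDerivAt q' (q'' b) b)
    (hκ : ∀ b, |b| ≤ r → 2 * κ ≤ q'' b) {a : ℝ} (ha : |a| ≤ r) :
    q 0 + a * q' 0 + κ * a ^ 2 ≤ q a := by
  set p : ℝ → ℝ := fun b => q b - κ * b ^ 2 with hp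
  set p' : ℝ → ℝ := fun b => q' b - 2 * κ * b with hp'
  have e1 : ∀ b : ℝ, |b| ≤ r → HasDerivAt p (p' b) b := fun b hb => by
    have h2 := (d1 b hb).sub (((hasDerivAt_id b).pow 2).const_mul κ)
    refine HasDerivAt.congr_deriv h2 ?_
    simp [hp']; ring
  have e2 : ∀ b : ℝ, |b| ≤ r → HasDerivAt p' (q'' b - 2 * κ) b := fun b hb => by
    have h2 := (d2 b hb).sub ((hasDerivAt_id b).const_mul (2 * κ))
    refine HasDerivAt.congr_deriv h2 ?_
    simp
  set I : Set ℝ := Set.Icc (-r) r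
  have hint : ∀ b ∈ interior I, |b| ≤ r := fun b hb => abs_le.2 (interior_subset hb : b ∈ I)
  have hmono : MonotoneOn p' I :=
    monotoneOn_of_hasDerivWithinAt_nonneg (convex_Icc _ _)
      (fun b hb => (e2 b (abs_le.2 hb)).continuousAt.continuousWithinAt)
      (fun b hb => (e2 b (hint b hb)).hasDerivWithinAt)
      fun b hb => by linarith [hκ b (hint b hb)]
  have hconv : ConvexOn ℝ I p := by
    refine MonotoneOn.convexOn_of_deriv (convex_Icc _ _)
      (fun b hb => (e1 b (abs_le.2 hb)).continuousAt.continuousWithinAt)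
      (fun b hb => (e1 b (hint b hb)).differentiableAt.differentiableWithinAt)
      ?_
    intro b hb c hc hbc
    rw [(e1 b (hint b hb)).deriv, (e1 c (hint c hc)).deriv]
    exact hmono (interior_subset hb) (interior_subset hc) hbc
  have hr : 0 ≤ r := (abs_nonneg a).trans ha
  have h0 : (0 : ℝ) ∈ I := by constructor <;> linarith
  have haI : a ∈ I := abs_le.1 ha
  have hd0 := e1 0 (by simpa using hr)
  have hmain : p 0 + a * p' 0 ≤ p a := by
    rcases lt_trichotomy a 0 with h | h | h
    · have := hconv.slope_le_of_hasDerivAt haI h0 h hd0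
      rw [slope_def_field, div_le_iff₀ (by linarith)] at this
      linarith
    · simp [h]
    · have := hconv.le_slope_of_hasDerivAt h0 haI h hd0
      rw [slope_def_field, le_div_iff₀ (by linarith)] at this
      linarith
  simp [hp, hp'] at hmain
  linarith

/-- A function which is strictly convex in a direction lies locally above its tangents,
with a quadratic margin. -/
theorem exists_quadratic_lower_bound {E : Type*} [NormedAddCommGroup E] [NormedSpace ℝ E]
    {φ : E → ℝ} {G : E → E} {x₀ : E}
    (hφ : ContDiffAt ℝ ∞ φ x₀) (hG : ContinuousAt G x₀)
    (hpos : 0 < fderiv ℝ (fderiv ℝ φ) x₀ (G x₀) (G x₀)) :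
    ∃ κ > 0, ∃ r > 0, ∀ x, ‖x - x₀‖ ≤ r → ∀ a : ℝ, |a| ≤ r →
      φ x + a * fderiv ℝ φ x (G x) + κ * a ^ 2 ≤ φ (x + a • G x) := by
  set m := fderiv ℝ (fderiv ℝ φ) x₀ (G x₀) (G x₀) with hm
  -- By continuity the second derivative stays above `m / 2` near `x₀`, and a margin `κ a²` needs
  -- the bound `2κ`.
  refine ⟨m / 4, by positivity, ?_⟩
  have hφ2 : ContDiffAt ℝ ∞ (fderiv ℝ φ) x₀ := hφ.fderiv_right (m := ∞) le_rfl
  have hφ3 : ContDiffAt ℝ ∞ (fderiv ℝ (fderiv ℝ φ)) x₀ := hφ2.fderiv_right (m := ∞) le_rfl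
  have hline : ContinuousAt (fun p : E × ℝ => p.1 + p.2 • G p.1) (x₀, 0) := by
    have : ContinuousAt (fun p : E × ℝ => G p.1) (x₀, 0) :=
      ContinuousAt.comp (f := Prod.fst) (g := G) hG continuousAt_fst
    exact continuousAt_fst.add (continuousAt_snd.smul this)
  have hline' : Tendsto (fun p : E × ℝ => p.1 + p.2 • G p.1) (𝓝 (x₀, 0)) (𝓝 x₀) := by
    simpa [ContinuousAt] using hline
  have hsec : ContinuousAt (fun p : E × ℝ =>
      fderiv ℝ (fderiv ℝ φ) (p.1 + p.2 • G p.1) (G p.1) (G p.1)) (x₀, 0) := by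
    have h1 : ContinuousAt (fun p : E × ℝ => G p.1) (x₀, 0) :=
      ContinuousAt.comp (f := Prod.fst) (g := G) hG continuousAt_fst
    have h2 : ContinuousAt (fun p : E × ℝ => fderiv ℝ (fderiv ℝ φ) (p.1 + p.2 • G p.1)) (x₀, 0) :=
      ContinuousAt.comp (f := fun p : E × ℝ => p.1 + p.2 • G p.1)
        (by simpa using hφ3.continuousAt) hline
    exact (h2.clm_apply h1).clm_apply h1
  have hsec' : ∀ᶠ p : E × ℝ in 𝓝 (x₀, 0),
      m / 2 < fderiv ℝ (fderiv ℝ φ) (p.1 + p.2 • G p.1) (G p.1) (G p.1) := by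
    refine hsec.eventually (lt_mem_nhds ?_)
    simp only [zero_smul, add_zero]
    rw [← hm]; linarith
  obtain ⟨r, hr, hball⟩ := Metric.eventually_nhds_iff.1 (hsec'.and
    ((hline'.eventually (eventually_differentiableAt hφ)).and
      (hline'.eventually (eventually_differentiableAt hφ2))))
  refine ⟨r / 2, by positivity, fun x hx a ha => ?_⟩
  have hin : ∀ b : ℝ, |b| ≤ r / 2 → dist ((x, b) : E × ℝ) (x₀, 0) < r := by
    intro b hb
    rw [Prod.dist_eq, max_lt_iff]
    exact ⟨by rw [dist_eq_norm]; linarith, by simpa using (by linarith : |b| < r)⟩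
  have hl : ∀ b : ℝ, HasDerivAt (fun b : ℝ => x + b • G x) (G x) b := fun b => by
    simpa using ((hasDerivAt_id b).smul_const (G x)).const_add x
  have d1 : ∀ b : ℝ, |b| ≤ r / 2 → HasDerivAt (fun b => φ (x + b • G x))
      (fderiv ℝ φ (x + b • G x) (G x)) b := fun b hb =>
    (hball (hin b hb)).2.1.hasFDerivAt.comp_hasDerivAt b (hl b)
  have d2 : ∀ b : ℝ, |b| ≤ r / 2 → HasDerivAt (fun b => fderiv ℝ φ (x + b • G x) (G x))
      (fderiv ℝ (fderiv ℝ φ) (x + b • G x) (G x) (G x)) b := fun b hb => by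
    have hD : DifferentiableAt ℝ (fderiv ℝ φ) (x + b • G x) := (hball (hin b hb)).2.2
    have h1 : HasDerivAt (fun b : ℝ => fderiv ℝ φ (x + b • G x))
        (fderiv ℝ (fderiv ℝ φ) (x + b • G x) (G x)) b :=
      hD.hasFDerivAt.comp_hasDerivAt b (hl b)
    exact (ContinuousLinearMap.apply ℝ ℝ (G x)).hasFDerivAt.comp_hasDerivAt b h1
  have := quadratic_lower_bound_of_second_deriv (κ := m / 4) d1 d2
    (fun b hb => by have := (hball (hin b hb)).1; simp only at this; linarith) ha
  simpa using this

end Geometry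

/-! ### Local estimates for one step, and telescoping along the SGD path. -/

section LocalControl

open scoped ContDiff

variable {E : Type*} [NormedAddCommGroup E] [InnerProductSpace ℝ E] [CompleteSpace E]

theorem exists_local_bound {E : Type*} [NormedAddCommGroup E] [NormedSpace ℝ E]
    {F : E → ℝ} {x₀ : E} (h : DifferentiableAt ℝ F x₀) :
    ∃ K, ∀ᶠ x in 𝓝 x₀, |F x - F x₀| ≤ K * ‖x - x₀‖ := by
  obtain ⟨K, hK⟩ := h.hasFDerivAt.isBigO_sub.bound
  exact ⟨K, by simpa using hK⟩

/-- Collects all analytic input for the probabilistic argument: one ball on which `φ` gains `κ a²`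
per step up to a cubically small drift, with a single constant `K` for all bounds. -/
theorem exists_local_control {F : E → ℝ} (hF : ContDiff ℝ ∞ F) {x₀ : E}
    (hne : ¬ ∃ l : ℝ, fderiv ℝ (gradient F) x₀ (gradient F x₀) = l • gradient F x₀) :
    ∃ (φ h : E → ℝ) (κ r K : ℝ), 0 < κ ∧ 0 < r ∧ 0 < K ∧
      ContinuousOn h (Metric.closedBall x₀ r) ∧
      (∀ x ∈ Metric.closedBall x₀ r, |h x| ≤ K ∧ |F x - F x₀| ≤ K * ‖x - x₀‖ ∧
        ‖gradient F x‖ ≤ K ∧ |φ x - φ x₀| ≤ K * ‖x - x₀‖) ∧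
      ∀ x ∈ Metric.closedBall x₀ r, ∀ a : ℝ, |a| ≤ r →
        φ x + a * ((F x - F x₀) ^ 3 * h x) + κ * a ^ 2 ≤ φ (x + a • gradient F x) := by
  have hG := contDiff_gradient hF
  set g := gradient F x₀ with hg
  set w := fderiv ℝ (gradient F) x₀ g with hw
  have hg0 : g ≠ 0 := fun h0 => hne ⟨0, by rw [hw, h0]; simp⟩
  -- The component of `-D(∇F)·∇F` orthogonal to `∇F`; it is nonzero exactly because the two vectors
  -- are not parallel.
  set v : E := (inner ℝ g w / ‖g‖ ^ 2) • g - w with hv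
  have hv0 : v ≠ 0 := fun h0 => hne ⟨_, (sub_eq_zero.1 h0).symm⟩
  have hvg : inner ℝ v g = 0 := by
    have : ‖g‖ ^ 2 ≠ 0 := by simpa using hg0
    rw [hv, inner_sub_left, real_inner_smul_left, real_inner_self_eq_norm_sq,
      real_inner_comm g w]
    field_simp
    simp
  have hvw : - inner ℝ v w = ‖v‖ ^ 2 := by
    have hw' : w = (inner ℝ g w / ‖g‖ ^ 2) • g - v := by rw [hv]; abel
    rw [hw', inner_sub_right, real_inner_smul_right, hvg, real_inner_self_eq_norm_sq]
    ring
  -- Order 3 is needed: on a ball of radius `η^0.44` the drift error per step is `O(η ·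
  -- η^(0.44·3))`, which is `o(η²)`, whereas order 2 would give only `η^1.88`.
  obtain ⟨φ, h, hφ, hh, hev, hd⟩ := exists_approx_invariant hF hg0 hvg 3
  have hsec := second_fderiv_of_approx_invariant (k := 1) hF hφ hh hev hd
  have hpos : 0 < fderiv ℝ (fderiv ℝ φ) x₀ (gradient F x₀) (gradient F x₀) := by
    rw [hsec, ← hg, ← hw, hvw]
    have := norm_pos_iff.2 hv0
    positivity
  obtain ⟨κ, hκ, r₁, hr₁, hlow⟩ := exists_quadratic_lower_bound hφ hG.continuous.continuousAt hpos
  obtain ⟨K₁, hK₁⟩ := exists_local_bound ((hF.differentiable (by simp)).differentiableAt (x := x₀))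
  obtain ⟨K₂, hK₂⟩ := exists_local_bound (hφ.differentiableAt (by simp))
  have hh1 : ∀ᶠ x in 𝓝 x₀, |h x| < |h x₀| + 1 :=
    hh.continuousAt.abs.eventually (gt_mem_nhds (by linarith))
  have hG1 : ∀ᶠ x in 𝓝 x₀, ‖gradient F x‖ < ‖gradient F x₀‖ + 1 :=
    hG.continuous.continuousAt.norm.eventually (gt_mem_nhds (by linarith))
  obtain ⟨r₂, hr₂, hall⟩ := Metric.eventually_nhds_iff.1
    (hev.and (hK₁.and (hK₂.and (hh1.and (hG1.and (eventually_differentiableAt hh))))))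
  set K := |K₁| + |K₂| + (|h x₀| + 1) + (‖gradient F x₀‖ + 1) with hK
  have hmem : ∀ x ∈ Metric.closedBall x₀ (min r₁ (r₂ / 2)), ‖x - x₀‖ ≤ r₁ ∧ dist x x₀ < r₂ := by
    intro x hx
    rw [Metric.mem_closedBall, le_min_iff] at hx
    exact ⟨by rw [← dist_eq_norm]; exact hx.1, by linarith [hx.2]⟩
  have hle : ∀ L : ℝ, |L| ≤ K → ∀ x : E, L * ‖x - x₀‖ ≤ K * ‖x - x₀‖ := fun L hL x =>
    mul_le_mul_of_nonneg_right ((le_abs_self L).trans hL) (norm_nonneg _)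
  have p1 := abs_nonneg K₁
  have p2 := abs_nonneg K₂
  have p3 := abs_nonneg (h x₀)
  have p4 := norm_nonneg (gradient F x₀)
  refine ⟨φ, h, κ, min r₁ (r₂ / 2), K, hκ, by positivity, by positivity, ?_, ?_, ?_⟩
  · exact fun x hx => (hall (hmem x hx).2).2.2.2.2.2.continuousAt.continuousWithinAt
  · intro x hx
    obtain ⟨-, h2, h3, h4, h5, -⟩ := hall (hmem x hx).2
    exact ⟨by linarith, h2.trans (hle _ (by linarith) x), by linarith,
      h3.trans (hle _ (by linarith) x)⟩
  · intro x hx a ha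
    rw [← (hall (hmem x hx).2).1]
    exact hlow x (hmem x hx).1 a (ha.trans (min_le_left _ _))

theorem sgdStep_eq {F : E → ℝ} (hF : Differentiable ℝ F) (y η z : ℝ) (θ : E) :
    sgdStep F y η z θ = θ + (2 * η * (z - (F θ - y))) • gradient F θ := by
  have h1 : HasFDerivAt (fun θ' => (F θ' - (y + z)) ^ 2) _ θ :=
    ((hF θ).hasFDerivAt.sub_const (y + z)).pow 2
  have h2 : gradient (fun θ' => (F θ' - (y + z)) ^ 2) θ = (2 * (F θ - (y + z))) • gradient F θ := by
    rw [gradient, h1.fderiv]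
    simp [gradient]
  rw [sgdStep, h2, smul_smul, sub_eq_add_neg, ← neg_smul]
  congr 2
  ring

theorem sgdPath_congr (F : E → ℝ) (y η : ℝ) (θ₀ : E) {z z' : ℕ → ℝ} {t : ℕ}
    (h : ∀ s < t, z s = z' s) : sgdPath F y η z θ₀ t = sgdPath F y η z' θ₀ t := by
  induction t with
  | zero => rfl
  | succ t ih =>
    simp only [sgdPath]
    rw [ih fun s hs => h s (by omega), h t (by omega)]

theorem measurable_sgdPath [MeasurableSpace E] [BorelSpace E] [SecondCountableTopology E]
    {F : E → ℝ} (hF : ContDiff ℝ ∞ F) (y η : ℝ) (θ₀ : E) (t : ℕ) :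
    Measurable fun z : ℕ → ℝ => sgdPath F y η z θ₀ t := by
  induction t with
  | zero => exact measurable_const
  | succ t ih =>
    have hc : Continuous fun p : ℝ × E => sgdStep F y η p.1 p.2 := by
      simp_rw [sgdStep_eq (hF.differentiable (by simp))]
      have := hF.continuous
      have := (contDiff_gradient hF).continuous
      fun_prop
    exact hc.measurable.comp ((measurable_pi_apply t).prodMk ih)

/-- Telescoping up to the first exit from a ball. -/
theorem sum_until_exit_le {E : Type*} [NormedAddCommGroup E] {φ : E → ℝ} {x₀ : E} {x : ℕ → E}
    {q : ℕ → ℝ} {ρ D : ℝ} (hρ : 0 ≤ ρ) (hx0 : x 0 = x₀)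
    (hstep : ∀ t, ‖x t - x₀‖ ≤ ρ →
      q t ≤ φ (x (t + 1)) - φ (x t) ∧ ‖x (t + 1) - x₀‖ ≤ 2 * ρ)
    (hD : ∀ u, ‖u - x₀‖ ≤ 2 * ρ → φ u - φ x₀ ≤ D) (T : ℕ) :
    ∑ t ∈ Finset.range T, {t | ∀ s ≤ t, ‖x s - x₀‖ ≤ ρ}.indicator q t ≤ D := by
  -- `u` is the path stopped at its first position outside the ball. That position may overshoot,
  -- whence the radius `2 * ρ`; the last clause lets the induction continue while the path has not
  -- left.
  suffices h : ∃ u, ‖u - x₀‖ ≤ 2 * ρ ∧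
      ∑ t ∈ Finset.range T, {t | ∀ s ≤ t, ‖x s - x₀‖ ≤ ρ}.indicator q t ≤ φ u - φ x₀ ∧
      ((∀ s < T, ‖x s - x₀‖ ≤ ρ) → u = x T) by
    obtain ⟨u, h1, h2, -⟩ := h
    exact h2.trans (hD u h1)
  induction T with
  | zero => exact ⟨x₀, by simpa using hρ, by simp, fun _ => hx0.symm⟩
  | succ T ih =>
    obtain ⟨u, h1, h2, h3⟩ := ih
    rw [Finset.sum_range_succ]
    by_cases hT : ∀ s ≤ T, ‖x s - x₀‖ ≤ ρ
    · rw [h3 fun s hs => hT s hs.le] at h2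
      refine ⟨x (T + 1), (hstep T (hT T le_rfl)).2, ?_, fun _ => rfl⟩
      rw [Set.indicator_of_mem (by exact hT)]
      linarith [(hstep T (hT T le_rfl)).1]
    · refine ⟨u, h1, ?_, fun h => absurd (fun s hs => h s (by omega)) hT⟩
      rw [Set.indicator_of_notMem (by exact hT)]
      linarith

end LocalControl

/-! ### Independence of the current noise from the past. -/

section Noise

variable {Ω : Type*} [MeasurableSpace Ω] {μ : Measure Ω} {Z : ℕ → Ω → ℝ}

theorem IsLabelNoise.indepFun_past (hZ : IsLabelNoise μ Z) {t : ℕ} {V : (ℕ → ℝ) → ℝ}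
    (hV : Measurable V) (hdep : ∀ z z' : ℕ → ℝ, (∀ s < t, z s = z' s) → V z = V z') :
    IndepFun (fun ω => V fun s => Z s ω) (Z t) μ := by
  classical
  have h := hZ.indep.indepFun_finset (Finset.range t) {t} (by simp) hZ.measurable
  -- Padding the first `t` coordinates by zero makes `V` a measurable function of finitely many
  -- noises, as `V` does not see the later ones.
  have hext : Measurable fun (u : Finset.range t → ℝ) (s : ℕ) =>
      if h : s ∈ Finset.range t then u ⟨s, h⟩ else 0 := by
    refine measurable_pi_lambda _ fun s => ?_
    by_cases hs : s ∈ Finset.range t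
    · simpa only [hs, dite_true] using measurable_pi_apply _
    · simpa only [hs, dite_false] using measurable_const
  have h2 := h.comp (hV.comp hext)
    (measurable_pi_apply (⟨t, Finset.mem_singleton_self t⟩ : ({t} : Finset ℕ)))
  have e : (fun ω => V fun s => Z s ω) = (V ∘ fun (u : Finset.range t → ℝ) (s : ℕ) =>
      if h : s ∈ Finset.range t then u ⟨s, h⟩ else 0) ∘ fun ω i => Z (↑i) ω := by
    ext ω
    refine hdep _ _ fun s hs => ?_
    simp [hs]
  rw [e]
  exact h2

theorem IsLabelNoise.integral_sq [IsProbabilityMeasure μ] (hZ : IsLabelNoise μ Z) (t : ℕ) :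
    ∫ ω, Z t ω ^ 2 ∂μ = 1 := by
  rw [← hZ.unit_variance t, variance_of_integral_eq_zero (hZ.measurable t).aemeasurable
    (hZ.mean_zero t)]

/-- The expected gain of one step taken while a past-dependent quantity `U` is switched on. -/
theorem IsLabelNoise.integral_step [IsProbabilityMeasure μ] (hZ : IsLabelNoise μ Z) {t : ℕ}
    {U W : (ℕ → ℝ) → ℝ} (hU : Measurable U) (hW : Measurable W) {C : ℝ}
    (hUC : ∀ z, |U z| ≤ C) (hWC : ∀ z, |W z| ≤ C)
    (hUd : ∀ z z' : ℕ → ℝ, (∀ s < t, z s = z' s) → U z = U z')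
    (hWd : ∀ z z' : ℕ → ℝ, (∀ s < t, z s = z' s) → W z = W z') (m : ℝ) :
    Integrable (fun ω => (W fun s => Z s ω) * Z t ω +
      m * (2 * ((U fun s => Z s ω) * Z t ω ^ 2) - U fun s => Z s ω)) μ ∧
    ∫ ω, ((W fun s => Z s ω) * Z t ω +
      m * (2 * ((U fun s => Z s ω) * Z t ω ^ 2) - U fun s => Z s ω)) ∂μ =
      m * ∫ ω, (U fun s => Z s ω) ∂μ := by
  obtain ⟨B, hB⟩ := hZ.bounded
  have hmeas : Measurable fun ω s => Z s ω := measurable_pi_lambda _ fun s => hZ.measurable s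
  have hUm := hU.comp hmeas
  have hWm := hW.comp hmeas
  have hZt := hZ.measurable t
  have hC : 0 ≤ C := (abs_nonneg _).trans (hUC 0)
  have i1 : Integrable (fun ω => (W fun s => Z s ω) * Z t ω) μ := by
    refine Integrable.of_bound (hWm.mul hZt).aestronglyMeasurable (C * B) ?_
    filter_upwards [hB t] with ω hω
    rw [Real.norm_eq_abs, abs_mul]
    exact mul_le_mul (hWC _) hω (abs_nonneg _) hC
  have i2 : Integrable (fun ω => (U fun s => Z s ω) * Z t ω ^ 2) μ := by
    refine Integrable.of_bound (hUm.mul (hZt.pow_const 2)).aestronglyMeasurable (C * B ^ 2) ?_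
    filter_upwards [hB t] with ω hω
    rw [Real.norm_eq_abs, abs_mul, abs_pow]
    exact mul_le_mul (hUC _) (pow_le_pow_left₀ (abs_nonneg _) hω 2) (by positivity) hC
  have i3 : Integrable (fun ω => U fun s => Z s ω) μ :=
    Integrable.of_bound hUm.aestronglyMeasurable C (Eventually.of_forall fun ω => hUC _)
  have e1 : ∫ ω, (W fun s => Z s ω) * Z t ω ∂μ = 0 := by
    have := (hZ.indepFun_past hW hWd).integral_mul_eq_mul_integral hWm.aestronglyMeasurable
      hZt.aestronglyMeasurable
    rw [hZ.mean_zero, mul_zero] at this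
    exact this
  have e2 : ∫ ω, (U fun s => Z s ω) * Z t ω ^ 2 ∂μ = ∫ ω, (U fun s => Z s ω) ∂μ := by
    have := ((hZ.indepFun_past hU hUd).comp measurable_id
      (measurable_id.pow_const 2)).integral_mul_eq_mul_integral hUm.aestronglyMeasurable
      (hZt.pow_const 2).aestronglyMeasurable
    have h2 := hZ.integral_sq t
    simp only [Function.comp_def, id, Pi.mul_apply] at this
    rw [this, h2, mul_one]
  have i4 : Integrable (fun ω => m * (2 * ((U fun s => Z s ω) * Z t ω ^ 2) -
      U fun s => Z s ω)) μ := ((i2.const_mul 2).sub i3).const_mul m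
  refine ⟨i1.add i4, ?_⟩
  rw [integral_add i1 i4, e1, integral_const_mul,
    integral_sub (i2.const_mul 2) i3, integral_const_mul, e2]
  ring

end Noise

/-! ### The drift argument: non-repellent points satisfy the parallelism condition. -/

section NonRepellent


theorem eventually_const_mul_rpow_lt (C : ℝ) {s ε : ℝ} (hs : 0 < s) (hε : 0 < ε) :
    ∀ᶠ η : ℝ in 𝓝[>] 0, C * η ^ s < ε := by
  have h : Tendsto (fun η : ℝ => C * η ^ s) (𝓝[>] 0) (𝓝 (C * 0 ^ s)) :=
    ((Real.continuousAt_rpow_const 0 s (Or.inr hs.le)).tendsto.mono_left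
      nhdsWithin_le_nhds).const_mul C
  rw [Real.zero_rpow hs.ne', mul_zero] at h
  exact h.eventually (gt_mem_nhds hε)

theorem eventually_half_le_one_sub_exp {p : ℝ} (hp : 0 < p) :
    ∀ᶠ η : ℝ in 𝓝[>] 0, 1 / 2 ≤ 1 - Real.exp (-(1 / η ^ p)) := by
  filter_upwards [eventually_const_mul_rpow_lt 1 hp one_pos, self_mem_nhdsWithin] with η h1 h2
  have hη : 0 < η ^ p := Real.rpow_pos_of_pos h2 p
  have h3 : 1 ≤ 1 / η ^ p := by rw [le_div_iff₀ hη]; linarith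
  have h4 : Real.exp (1 / η ^ p) ≥ 2 := by linarith [Real.add_one_le_exp (1 / η ^ p)]
  rw [Real.exp_neg]
  have : (Real.exp (1 / η ^ p))⁻¹ ≤ 2⁻¹ := inv_anti₀ (by norm_num) h4
  linarith

/-- Put `a = 2η(z - e)` and expand. Terms linear in `z` are collected on the left, since they
average to zero given the past; `4κη²e²` is dropped, and the drift `-2ηeL` costs at most `2κη²`. As
`z²` has mean 1, a mean gain of `2κη²` remains. -/
theorem one_step_gain {η κ e L R : ℝ} (hη : 0 < η) (hκ : 0 < κ) (he : |e| ≤ R)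
    (hL : R * |L| ≤ κ * η) (z : ℝ) :
    z * (2 * η * (L - 4 * κ * η * e)) + 2 * κ * η ^ 2 * (2 * z ^ 2 - 1) ≤
      2 * η * (z - e) * L + κ * (2 * η * (z - e)) ^ 2 := by
  have h1 : e * L ≤ κ * η := by
    calc e * L ≤ |e * L| := le_abs_self _
      _ = |e| * |L| := abs_mul _ _
      _ ≤ R * |L| := mul_le_mul_of_nonneg_right he (abs_nonneg _)
      _ ≤ _ := hL
  have h2 : 0 ≤ η * (κ * η - e * L) := mul_nonneg hη.le (by linarith)
  have h3 : 0 ≤ κ * (η * e) ^ 2 := by positivity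
  nlinarith

variable {E : Type*} [NormedAddCommGroup E] [InnerProductSpace ℝ E] [CompleteSpace E]
  [MeasurableSpace E] [BorelSpace E] [SecondCountableTopology E]
  {Ω : Type*} [MeasurableSpace Ω] {μ : Measure Ω} {Z : ℕ → Ω → ℝ}

/-- If a gain `z * Q θ + m * (2 * z ^ 2 - 1)` in every step is a lower bound for the increments of
a function on a ball, then the path stays in the ball only for a bounded expected time. -/
theorem sum_stay_probability_le [IsProbabilityMeasure μ] (hZ : IsLabelNoise μ Z)
    {F : E → ℝ} (hF : ContDiff ℝ (⊤ : ℕ∞) F) {y η B C ρ m D : ℝ} {x₀ : E} {φ Q : E → ℝ} (hρ : 0 ≤ ρ)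
    (hB : ∀ t, ∀ᵐ ω ∂μ, |Z t ω| ≤ B)
    (hQ : ContinuousOn Q (Metric.closedBall x₀ ρ)) (hQC : ∀ x, ‖x - x₀‖ ≤ ρ → |Q x| ≤ C)
    (hstep : ∀ x, ‖x - x₀‖ ≤ ρ → ∀ z, |z| ≤ B →
      z * Q x + m * (2 * z ^ 2 - 1) ≤ φ (sgdStep F y η z x) - φ x ∧
        ‖sgdStep F y η z x - x₀‖ ≤ 2 * ρ)
    (hD : ∀ u, ‖u - x₀‖ ≤ 2 * ρ → φ u - φ x₀ ≤ D) (T : ℕ) :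
    ∑ t ∈ Finset.range T, m * μ.real {ω | ∀ s ≤ t,
      ‖sgdPath F y η (fun s => Z s ω) x₀ s - x₀‖ ≤ ρ} ≤ D := by
  classical
  set X : (ℕ → ℝ) → ℕ → E := fun z t => sgdPath F y η z x₀ t with hX
  set A : ℕ → Set (ℕ → ℝ) := fun t => {z | ∀ s ≤ t, ‖X z s - x₀‖ ≤ ρ} with hA
  have hAm : ∀ t, MeasurableSet (A t) := fun t => by
    have : A t = ⋂ s ≤ t, {z | ‖X z s - x₀‖ ≤ ρ} := by ext z; simp [hA]
    rw [this]
    refine MeasurableSet.iInter fun s => MeasurableSet.iInter fun _ => ?_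
    exact measurableSet_le ((measurable_sgdPath hF y η x₀ s).sub_const x₀).norm measurable_const
  set U : ℕ → (ℕ → ℝ) → ℝ := fun t => (A t).indicator fun _ => 1 with hU
  -- `Q` is controlled only on the ball; cutting it off gives a globally measurable function, and
  -- the indicator `U` hides the change.
  set Q' : E → ℝ := (Metric.closedBall x₀ ρ).piecewise Q (fun _ => 0) with hQ'
  have hQ'm : Measurable Q' :=
    hQ.measurable_piecewise continuousOn_const Metric.isClosed_closedBall.measurableSet
  have hQ'eq : ∀ x, ‖x - x₀‖ ≤ ρ → Q' x = Q x := fun x hx =>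
    Set.piecewise_eq_of_mem _ _ _ (by rwa [Metric.mem_closedBall, dist_eq_norm])
  have hC : 0 ≤ C := (abs_nonneg _).trans (hQC x₀ (by simpa using hρ))
  have hQ'C : ∀ x, |Q' x| ≤ C := fun x => by
    by_cases hx : x ∈ Metric.closedBall x₀ ρ
    · rw [hQ', Set.piecewise_eq_of_mem _ _ _ hx]
      exact hQC x (by rwa [Metric.mem_closedBall, dist_eq_norm] at hx)
    · rw [hQ', Set.piecewise_eq_of_notMem _ _ _ hx]
      simpa using hC
  have hUm : ∀ t, Measurable (U t) := fun t => measurable_const.indicator (hAm t)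
  have hU1 : ∀ t z, |U t z| ≤ 1 := fun t z => by
    by_cases hz : z ∈ A t <;> simp [hU, hz]
  have hXd : ∀ t, ∀ z z' : ℕ → ℝ, (∀ s < t, z s = z' s) → ∀ s ≤ t, X z s = X z' s :=
    fun t z z' h s hs => sgdPath_congr F y η x₀ fun r hr => h r (by omega)
  have hUd : ∀ t, ∀ z z' : ℕ → ℝ, (∀ s < t, z s = z' s) → U t z = U t z' := by
    intro t z z' h
    have : z ∈ A t ↔ z' ∈ A t :=
      forall₂_congr fun s hs => by rw [hXd t z z' h s hs]
    by_cases hz : z ∈ A t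
    · simp [hU, hz, this.1 hz]
    · simp [hU, hz, mt this.2 hz]
  set W : ℕ → (ℕ → ℝ) → ℝ := fun t z => U t z * Q' (X z t) with hW
  have hWm : ∀ t, Measurable (W t) := fun t =>
    (hUm t).mul (hQ'm.comp (measurable_sgdPath hF y η x₀ t))
  have hWC : ∀ t z, |W t z| ≤ max 1 C := fun t z => by
    rw [hW, abs_mul]
    exact (mul_le_of_le_one_left (abs_nonneg _) (hU1 t z)).trans
      ((hQ'C _).trans (le_max_right _ _))
  have hWd : ∀ t, ∀ z z' : ℕ → ℝ, (∀ s < t, z s = z' s) → W t z = W t z' :=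
    fun t z z' h => by simp only [hW]; rw [hUd t z z' h, hXd t z z' h t le_rfl]
  have hint := fun t => hZ.integral_step (hUm t) (hWm t)
    (fun z => (hU1 t z).trans (le_max_left 1 C)) (hWC t) (hUd t) (hWd t) m
  have hUint : ∀ t, ∫ ω, U t (fun s => Z s ω) ∂μ = μ.real {ω | ∀ s ≤ t,
      ‖sgdPath F y η (fun s => Z s ω) x₀ s - x₀‖ ≤ ρ} := fun t => by
    have hmeas : Measurable fun ω s => Z s ω := measurable_pi_lambda _ fun s => hZ.measurable s
    exact integral_indicator_one (hmeas (hAm t))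
  have hsum := integral_finsetSum (μ := μ) (Finset.range T) fun t _ => (hint t).1
  rw [Finset.sum_congr rfl fun t _ => by rw [← hUint t, ← (hint t).2], ← hsum]
  have hball : ∀ᵐ ω ∂μ, ∀ t, |Z t ω| ≤ B := ae_all_iff.2 hB
  calc _ ≤ ∫ _, D ∂μ := by
        refine integral_mono_ae (integrable_finsetSum _ fun t _ => (hint t).1)
          (integrable_const D) ?_
        filter_upwards [hball] with ω hω
        refine le_trans (le_of_eq ?_) (sum_until_exit_le (φ := φ) (x := X fun s => Z s ω)
          (q := fun t => Z t ω * Q (X (fun s => Z s ω) t) + m * (2 * Z t ω ^ 2 - 1)) (D := D)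
          hρ rfl (fun t ht => hstep _ ht _ (hω t)) hD T)
        refine Finset.sum_congr rfl fun t _ => ?_
        by_cases ht : (fun s => Z s ω) ∈ A t
        · rw [Set.indicator_of_mem (by exact ht)]
          simp only [hW, hU, Set.indicator_of_mem ht, hQ'eq _ (ht t le_rfl)]
          ring
        · rw [Set.indicator_of_notMem (by exact ht)]
          simp only [hW, hU, Set.indicator_of_notMem ht]
          ring
    _ = D := by simp

/-- At a non-repellent point, the gradient of the regularizer `‖∇ F‖²` is parallel to `∇ F`. -/
theorem NonRepellent.exists_fderiv_gradient_eq [IsProbabilityMeasure μ] (hZ : IsLabelNoise μ Z)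
    {F : E → ℝ} (hF : ContDiff ℝ (⊤ : ℕ∞) F) {y : ℝ} {x₀ : E} (hθ : NonRepellent μ Z F y x₀) :
    ∃ l : ℝ, fderiv ℝ (gradient F) x₀ (gradient F x₀) = l • gradient F x₀ := by
  by_contra hne
  obtain ⟨φ, h, κ, r, K, hκ, hr, hK, hhc, hbd, hlow⟩ := exists_local_control hF hne
  obtain ⟨B, hB⟩ := hZ.bounded
  obtain ⟨p, hp, hev⟩ := hθ
  -- `R` bounds the residual on the ball and `M * η` the step coefficient. The point `x₀` need not
  -- fit the label `y`.
  set R := |F x₀ - y| + K * r with hR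
  have hR0 : 0 ≤ R := by positivity
  set M := 2 * (|B| + R) with hM
  have hM0 : 0 ≤ M := by positivity
  -- The exponents: `0.44` and `1` keep the ball and the step coefficient within `r`; `0.56 = 1 -
  -- 0.44` makes a step shorter than `ρ`; `0.32 = 3·0.44 - 1` makes the cubic drift negligible;
  -- `1.6` gives at least two steps, so that rounding loses at most half; `0.04 = 0.44 - 0.4` is the
  -- margin of the final contradiction.
  obtain ⟨η, h1, h2, h3, h4, h5, h6, h7, h8, hη⟩ := (hev.and
    ((eventually_half_le_one_sub_exp hp).and
    ((eventually_const_mul_rpow_lt 2 (s := 0.44) (by norm_num) hr).and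
    ((eventually_const_mul_rpow_lt M (s := 1) (by norm_num) hr).and
    ((eventually_const_mul_rpow_lt (M * K) (s := 0.56) (by norm_num) one_pos).and
    ((eventually_const_mul_rpow_lt (R * K ^ 4) (s := 0.32) (by norm_num) hκ).and
    ((eventually_const_mul_rpow_lt 2 (s := 1.6) (by norm_num) one_pos).and
    ((eventually_const_mul_rpow_lt (4 * K) (s := 0.04) (by norm_num) hκ).and
    self_mem_nhdsWithin)))))))).exists
  replace hη : 0 < η := hη
  set ρ := η ^ (0.44 : ℝ) with hρ
  have hρ0 : 0 < ρ := Real.rpow_pos_of_pos hη _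
  rw [Real.rpow_one] at h4
  have hstepsize : M * η * K ≤ ρ := by
    have : η = η ^ (0.56 : ℝ) * ρ := by
      rw [hρ, ← Real.rpow_add hη]; norm_num
    calc M * η * K = (M * K * η ^ (0.56 : ℝ)) * ρ := by
          conv_lhs => rw [this]
          ring
      _ ≤ 1 * ρ := by gcongr
      _ = ρ := one_mul ρ
  have hcube : R * K ^ 4 * ρ ^ 3 ≤ κ * η := by
    have : ρ ^ 3 = η ^ (0.32 : ℝ) * η := by
      conv_rhs => rw [← Real.rpow_add_one hη.ne']
      rw [hρ, ← Real.rpow_natCast, ← Real.rpow_mul hη.le]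
      norm_num
    calc R * K ^ 4 * ρ ^ 3 = (R * K ^ 4 * η ^ (0.32 : ℝ)) * η := by rw [this]; ring
      _ ≤ κ * η := by gcongr
  have hmem : ∀ x, ‖x - x₀‖ ≤ 2 * ρ → x ∈ Metric.closedBall x₀ r := fun x hx => by
    rw [Metric.mem_closedBall, dist_eq_norm]; linarith
  have hsub : Metric.closedBall x₀ ρ ⊆ Metric.closedBall x₀ r :=
    Metric.closedBall_subset_closedBall (by linarith)
  have herr : ∀ x ∈ Metric.closedBall x₀ r, |F x - y| ≤ R := fun x hx => by
    have e1 := (hbd x hx).2.1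
    rw [Metric.mem_closedBall, dist_eq_norm] at hx
    calc |F x - y| = |(F x₀ - y) + (F x - F x₀)| := by congr 1; ring
      _ ≤ |F x₀ - y| + |F x - F x₀| := abs_add_le _ _
      _ ≤ |F x₀ - y| + K * r := by
        gcongr
        exact e1.trans (by gcongr)
  have hflow : ∀ x, ‖x - x₀‖ ≤ ρ → |(F x - F x₀) ^ 3 * h x| ≤ K ^ 4 * ρ ^ 3 := fun x hx => by
    obtain ⟨e1, e2, -, -⟩ := hbd x (hmem x (by linarith))
    have e3 : |F x - F x₀| ≤ K * ρ := e2.trans (by gcongr)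
    rw [abs_mul, abs_pow]
    calc |F x - F x₀| ^ 3 * |h x| ≤ (K * ρ) ^ 3 * K := by gcongr
      _ = _ := by ring
  have hmain := sum_stay_probability_le hZ hF (y := y) (η := η) (B := |B|)
    (C := 2 * η * (K ^ 4 * ρ ^ 3 + 4 * κ * η * R)) (ρ := ρ) (m := 2 * κ * η ^ 2)
    (D := K * (2 * ρ)) (x₀ := x₀) (φ := φ)
    (Q := fun x => 2 * η * ((F x - F x₀) ^ 3 * h x - 4 * κ * η * (F x - y))) hρ0.le
    (fun t => (hB t).mono fun ω hω => hω.trans (le_abs_self B))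
    (by
      have := hF.continuous.continuousOn (s := Metric.closedBall x₀ ρ)
      have := hhc.mono hsub
      fun_prop)
    (fun x hx => by
      rw [abs_mul, abs_of_pos (by positivity : 0 < 2 * η)]
      gcongr
      refine (abs_sub _ _).trans (add_le_add (hflow x hx) ?_)
      rw [abs_mul, abs_of_pos (by positivity : 0 < 4 * κ * η)]
      gcongr
      exact herr x (hmem x (by linarith)))
    (fun x hx z hz => by
      have hxr := hmem x (by linarith)
      rw [sgdStep_eq (hF.differentiable (by simp))]
      have ha : |2 * η * (z - (F x - y))| ≤ M * η := by
        rw [abs_mul, abs_of_pos (by positivity : 0 < 2 * η), hM]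
        have := (abs_sub z (F x - y)).trans (add_le_add hz (herr x hxr))
        calc 2 * η * |z - (F x - y)| ≤ 2 * η * (|B| + R) := by gcongr
          _ = _ := by ring
      constructor
      · have g1 := hlow x hxr _ (ha.trans h4.le)
        have g2 := one_step_gain hη hκ (herr x hxr) (L := (F x - F x₀) ^ 3 * h x)
          (le_trans (by
            rw [mul_assoc]
            exact mul_le_mul_of_nonneg_left (hflow x hx) hR0) hcube) z
        linarith
      · calc ‖x + (2 * η * (z - (F x - y))) • gradient F x - x₀‖
            = ‖(x - x₀) + (2 * η * (z - (F x - y))) • gradient F x‖ := by congr 1; abel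
          _ ≤ ‖x - x₀‖ + ‖(2 * η * (z - (F x - y))) • gradient F x‖ := norm_add_le _ _
          _ ≤ ρ + M * η * K := by
            rw [norm_smul, Real.norm_eq_abs]
            gcongr
            exact (hbd x hxr).2.2.1
          _ ≤ 2 * ρ := by linarith)
    (fun u hu => (le_abs_self _).trans ((hbd u (hmem u hu)).2.2.2.trans (by gcongr)))
    ⌊η ^ (-1.6 : ℝ)⌋₊
  -- The path is started at the non-repellent point itself, and only probability `1/2` of staying is
  -- used.
  have hgood := h1 x₀ (by simpa using (Real.rpow_pos_of_pos hη _).le)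
  have hprob : ∀ t ∈ Finset.range ⌊η ^ (-1.6 : ℝ)⌋₊, 2 * κ * η ^ 2 * (1 / 2) ≤
      2 * κ * η ^ 2 * μ.real {ω | ∀ s ≤ t,
        ‖sgdPath F y η (fun s => Z s ω) x₀ s - x₀‖ ≤ ρ} := fun t ht => by
    gcongr
    refine h2.trans (hgood.trans (measureReal_mono fun ω hω s hs => hω s ?_))
    refine le_trans ?_ (Nat.floor_le (Real.rpow_pos_of_pos hη _).le)
    exact_mod_cast hs.trans (Finset.mem_range.1 ht).le
  -- Accumulated gain, of order `η² · η^(-1.6) = η^0.4`, against the oscillation of `φ`, of order `ρ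
  -- = η^0.44`.
  have hfin := (Finset.sum_le_sum hprob).trans hmain
  rw [Finset.sum_const, Finset.card_range, nsmul_eq_mul] at hfin
  set N := η ^ (-1.6 : ℝ) with hN
  have hN0 : 0 < N := Real.rpow_pos_of_pos hη _
  have hN1 : η ^ (1.6 : ℝ) * N = 1 := by
    rw [hN, ← Real.rpow_add hη]; norm_num
  have hN2 : 2 ≤ N := by
    have : (2 * η ^ (1.6 : ℝ)) * N ≤ 1 * N := by gcongr
    linarith
  have hfloor : N / 2 ≤ (⌊N⌋₊ : ℝ) := by linarith [Nat.lt_floor_add_one N]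
  have e1 : η ^ 2 * N = η ^ (0.4 : ℝ) := by
    rw [hN, ← Real.rpow_natCast, ← Real.rpow_add hη]; norm_num
  have e2 : ρ = η ^ (0.4 : ℝ) * η ^ (0.04 : ℝ) := by
    rw [hρ, ← Real.rpow_add hη]; norm_num
  have h40 : 0 < η ^ (0.4 : ℝ) := Real.rpow_pos_of_pos hη _
  have e3 : κ * η ^ (0.4 : ℝ) / 2 ≤ K * (2 * ρ) := by
    calc κ * η ^ (0.4 : ℝ) / 2 = N / 2 * (2 * κ * η ^ 2 * (1 / 2)) := by rw [← e1]; ring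
      _ ≤ ⌊N⌋₊ * (2 * κ * η ^ 2 * (1 / 2)) := by gcongr
      _ ≤ _ := hfin
  have e4 : 4 * K * η ^ (0.04 : ℝ) * η ^ (0.4 : ℝ) < κ * η ^ (0.4 : ℝ) := by gcongr
  rw [e2] at e3
  linarith

end NonRepellent

/-! ### The parallelism condition for a two-layer network, unit by unit. -/

section Network

variable {n d : ℕ}

/-- The preactivation `wᵢᵀ x` of the `i`-th unit, as a linear functional of the parameters. -/
noncomputable def preactivation (x : EuclideanSpace ℝ (Fin d)) (i : Fin n) : Params n d →L[ℝ] ℝ :=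
  ∑ j, x j • EuclideanSpace.proj (𝕜 := ℝ) (Sum.inr (i, j))

theorem preactivation_apply (x : EuclideanSpace ℝ (Fin d)) (i : Fin n) (θ : Params n d) :
    preactivation x i θ = ∑ j, x j * θ (Sum.inr (i, j)) := by
  simp [preactivation]

theorem hidden_eq (σ : ℝ → ℝ) (x : EuclideanSpace ℝ (Fin d)) (i : Fin n) (θ : Params n d) :
    hidden σ x θ i = σ (preactivation x i θ) := by
  rw [hidden, preactivation_apply]
  simp [PiLp.inner_apply, Params.w]

variable {σ σ₁ σ₂ : ℝ → ℝ}

theorem contDiff_network (hσ : ContDiff ℝ (⊤ : ℕ∞) σ) (x : EuclideanSpace ℝ (Fin d)) :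
    ContDiff ℝ (⊤ : ℕ∞) (network (n := n) σ x) := by
  have : network (n := n) σ x = fun θ : Params n d =>
      ∑ i, EuclideanSpace.proj (𝕜 := ℝ) (Sum.inl i) θ * σ (preactivation x i θ) := by
    ext θ
    simp [network, hidden_eq, Params.c]
  rw [this]
  exact ContDiff.sum fun i _ => (EuclideanSpace.proj (𝕜 := ℝ) (Sum.inl i)).contDiff.mul
    (hσ.comp (preactivation x i).contDiff)

theorem gradient_network (h1 : ∀ u, HasDerivAt σ (σ₁ u) u)
    (x : EuclideanSpace ℝ (Fin d)) (θ : Params n d) :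
    gradient (network σ x) θ = WithLp.toLp 2 (Sum.elim (fun i => σ (preactivation x i θ))
      fun p => θ (Sum.inl p.1) * σ₁ (preactivation x p.1 θ) * x p.2) := by
  have hd : HasFDerivAt (network σ x) (∑ i : Fin n, (θ (Sum.inl i) • σ₁ (preactivation x i θ) •
      preactivation x i + σ (preactivation x i θ) • EuclideanSpace.proj (𝕜 := ℝ) (Sum.inl i))) θ := by
    have : network (n := n) σ x = fun θ : Params n d =>
        ∑ i, EuclideanSpace.proj (𝕜 := ℝ) (Sum.inl i) θ * σ (preactivation x i θ) := by
      ext θ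
      simp [network, hidden_eq, Params.c]
    rw [this]
    refine HasFDerivAt.fun_sum fun i _ => ?_
    exact (EuclideanSpace.proj (𝕜 := ℝ) (Sum.inl i)).hasFDerivAt.mul
      ((h1 _).comp_hasFDerivAt θ (preactivation x i).hasFDerivAt)
  refine ext_inner_right ℝ fun v => ?_
  rw [← fderiv_apply_gradient, hd.fderiv]
  simp only [PiLp.inner_apply, Fintype.sum_sum_type, Fintype.sum_prod_type, Sum.elim_inl,
    Sum.elim_inr, sum_apply, add_apply, smul_apply, preactivation_apply, smul_eq_mul, PiLp.proj_apply,
    RCLike.inner_apply, conj_trivial]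
  rw [← Finset.sum_add_distrib]
  refine Finset.sum_congr rfl fun i _ => ?_
  rw [add_comm, Finset.mul_sum, Finset.mul_sum, mul_comm (σ _)]
  congr 1
  exact Finset.sum_congr rfl fun j _ => by ring

/-- The stationarity conditions for the output and hidden weights of every unit. -/
theorem stationarity_of_fderiv_gradient_eq (h1 : ∀ u, HasDerivAt σ (σ₁ u) u)
    (h2 : ∀ u, HasDerivAt σ₁ (σ₂ u) u) (hσ : ContDiff ℝ (⊤ : ℕ∞) σ)
    {x : EuclideanSpace ℝ (Fin d)} (hx : x ≠ 0) {θ : Params n d} {l : ℝ}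
    (hl : fderiv ℝ (gradient (network σ x)) θ (gradient (network σ x) θ) =
      l • gradient (network σ x) θ) (i : Fin n) :
    σ₁ (preactivation x i θ) * (Params.c θ i * σ₁ (preactivation x i θ) * ‖x‖ ^ 2) =
        l * hidden σ x θ i ∧
      hidden σ x θ i * σ₁ (preactivation x i θ) + Params.c θ i * (σ₂ (preactivation x i θ) *
        (Params.c θ i * σ₁ (preactivation x i θ) * ‖x‖ ^ 2)) =
        l * (Params.c θ i * σ₁ (preactivation x i θ)) := by
  have hdiff : DifferentiableAt ℝ (gradient (network σ x)) θ :=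
    ((contDiff_gradient (contDiff_network hσ x)).differentiable (by simp)).differentiableAt
  set g := gradient (network σ x) θ with hg
  have hgl : ∀ i, g (Sum.inl i) = σ (preactivation x i θ) := fun i => by
    rw [hg, gradient_network h1]; rfl
  have hgr : ∀ i j, g (Sum.inr (i, j)) = Params.c θ i * σ₁ (preactivation x i θ) * x j :=
    fun i j => by rw [hg, gradient_network h1]; rfl
  have hpg : ∀ i, preactivation x i g = Params.c θ i * σ₁ (preactivation x i θ) * ‖x‖ ^ 2 :=
    fun i => by
      rw [preactivation_apply, EuclideanSpace.real_norm_sq_eq, Finset.mul_sum]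
      exact Finset.sum_congr rfl fun j _ => by rw [hgr]; ring
  -- Each coordinate of the gradient involves a single unit, so differentiating coordinatewise
  -- avoids writing out the full Hessian.
  have hcoord : ∀ k (D : Params n d →L[ℝ] ℝ),
      HasFDerivAt (fun θ => gradient (network σ x) θ k) D θ → D g = l * g k := by
    intro k D hD
    have h := ((EuclideanSpace.proj (𝕜 := ℝ) k).hasFDerivAt.comp θ hdiff.hasFDerivAt).unique hD
    rw [← h]
    simp [hl]
  constructor
  · have := hcoord (Sum.inl i) (σ₁ (preactivation x i θ) • preactivation x i) (by
      simp_rw [gradient_network h1]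
      exact (h1 _).comp_hasFDerivAt θ (preactivation x i).hasFDerivAt)
    rw [hgl] at this
    simpa [hpg, hidden_eq] using this
  -- The equations for the weights `w i j` are all multiples by `x j` of the same one, so a single
  -- nonzero coordinate suffices.
  · obtain ⟨j, hj⟩ : ∃ j, x j ≠ 0 := by
      by_contra! h
      exact hx (by ext j; simpa using h j)
    have := hcoord (Sum.inr (i, j)) (x j • (θ (Sum.inl i) • σ₂ (preactivation x i θ) •
      preactivation x i + σ₁ (preactivation x i θ) • EuclideanSpace.proj (𝕜 := ℝ) (Sum.inl i))) (by
      simp_rw [gradient_network h1]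
      exact ((EuclideanSpace.proj (𝕜 := ℝ) (Sum.inl i)).hasFDerivAt.mul
        ((h2 _).comp_hasFDerivAt θ (preactivation x i).hasFDerivAt)).mul_const (x j))
    rw [hgr] at this
    simp only [smul_apply, add_apply, hpg, smul_eq_mul, PiLp.proj_apply, hgl] at this
    rw [hidden_eq]
    apply mul_left_cancel₀ hj
    rw [Params.c] at this ⊢
    linarith

end Network

/-! ### Solving the stationarity equations for `tanh` and the logistic function. -/

section Activation

theorem hasDerivAt_tanh (u : ℝ) : HasDerivAt Real.tanh (1 - Real.tanh u ^ 2) u := by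
  have hc := (Real.cosh_pos u).ne'
  have h := (Real.hasDerivAt_sinh u).div (Real.hasDerivAt_cosh u) hc
  have e : Real.tanh = Real.sinh / Real.cosh := by
    ext v; simp [Real.tanh_eq_sinh_div_cosh]
  rw [e]
  refine h.congr_deriv ?_
  simp only [Pi.div_apply]
  field_simp

theorem tanh_sq_lt_one (u : ℝ) : Real.tanh u ^ 2 < 1 := by
  have hc := Real.cosh_pos u
  rw [Real.tanh_eq_sinh_div_cosh, div_pow, div_lt_one (by positivity), Real.cosh_sq]
  linarith

theorem contDiff_tanh : ContDiff ℝ (⊤ : ℕ∞) Real.tanh := by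
  have e : Real.tanh = fun v => Real.sinh v / Real.cosh v := by
    ext v; simp [Real.tanh_eq_sinh_div_cosh]
  rw [e]
  exact Real.contDiff_sinh.div Real.contDiff_cosh fun v => (Real.cosh_pos v).ne'

/-- The derivative of `s(1-s)³` is `(1-s)²(1-4s)`, whose only zero below 1 is `1/4`, while three
equal values would by Rolle give two zeros. -/
theorem mul_one_sub_cube_eq_of_ne {a b c : ℝ} (hc : c < 1) (hab : a < b) (hbc : b < c)
    (h1 : a * (1 - a) ^ 3 = b * (1 - b) ^ 3) (h2 : b * (1 - b) ^ 3 = c * (1 - c) ^ 3) : False := by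
  have hd : ∀ s : ℝ, HasDerivAt (fun s => s * (1 - s) ^ 3) ((1 - s) ^ 2 * (1 - 4 * s)) s := by
    intro s
    refine ((hasDerivAt_id s).mul (((hasDerivAt_id s).const_sub 1).pow 3)).congr_deriv ?_
    simp
    ring
  have hcont : Continuous fun s : ℝ => s * (1 - s) ^ 3 := by fun_prop
  obtain ⟨s, hs, es⟩ := exists_hasDerivAt_eq_zero hab hcont.continuousOn h1 fun s _ => hd s
  obtain ⟨t, ht, et⟩ := exists_hasDerivAt_eq_zero hbc hcont.continuousOn h2 fun s _ => hd s
  have key : ∀ s : ℝ, s < 1 → (1 - s) ^ 2 * (1 - 4 * s) = 0 → s = 1 / 4 := by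
    intro s h e
    have : (1 - s) ^ 2 ≠ 0 := pow_ne_zero _ (by linarith)
    have := (mul_eq_zero.1 e).resolve_left this
    linarith
  have e1 := key s (by linarith [hs.2]) es
  have e2 := key t (by linarith [ht.2]) et
  linarith [hs.2, ht.1]

theorem eq_or_eq_of_mul_one_sub_cube_eq {a b c v : ℝ} (ha : a < 1) (hb : b < 1) (hc : c < 1)
    (ea : a * (1 - a) ^ 3 = v) (eb : b * (1 - b) ^ 3 = v) (ec : c * (1 - c) ^ 3 = v)
    (hab : a ≠ b) : c = a ∨ c = b := by
  by_contra! h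
  obtain ⟨h1, h2⟩ := h
  rcases lt_or_gt_of_ne hab with h | h <;> rcases lt_or_gt_of_ne h1 with h1 | h1 <;>
    rcases lt_or_gt_of_ne h2 with h2 | h2
  · exact mul_one_sub_cube_eq_of_ne hb h1 h (by rw [ec, ea]) (by rw [ea, eb])
  · linarith
  · exact mul_one_sub_cube_eq_of_ne hb h1 h2 (by rw [ec, ea]) (by rw [ec, eb])
  · exact mul_one_sub_cube_eq_of_ne hc h h2 (by rw [ea, eb]) (by rw [eb, ec])
  · exact mul_one_sub_cube_eq_of_ne ha h2 h (by rw [ec, eb]) (by rw [ea, eb])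
  · exact mul_one_sub_cube_eq_of_ne ha h2 h1 (by rw [ec, eb]) (by rw [ec, ea])
  · linarith
  · exact mul_one_sub_cube_eq_of_ne hc h h1 (by rw [ea, eb]) (by rw [ea, ec])

/-- The stationarity conditions of two active `tanh` units have solutions equal up to sign. -/
theorem tanh_units_eq_or_neg {X l c c' b b' : ℝ} (hX : 0 < X) (hb : b ^ 2 < 1) (hb' : b' ^ 2 < 1)
    (e1 : (1 - b ^ 2) * (c * (1 - b ^ 2) * X) = l * b)
    (e2 : b * (1 - b ^ 2) + c * (-(2 * b * (1 - b ^ 2)) * (c * (1 - b ^ 2) * X)) =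
      l * (c * (1 - b ^ 2)))
    (e1' : (1 - b' ^ 2) * (c' * (1 - b' ^ 2) * X) = l * b')
    (e2' : b' * (1 - b' ^ 2) + c' * (-(2 * b' * (1 - b' ^ 2)) * (c' * (1 - b' ^ 2) * X)) =
      l * (c' * (1 - b' ^ 2)))
    (h0 : ¬(c = 0 ∧ b = 0)) :
    (c' = c ∧ b' = b) ∨ (c' = -c ∧ b' = -b) ∨ (c' = 0 ∧ b' = 0) := by
  have out : ∀ c b : ℝ, b ^ 2 < 1 → (1 - b ^ 2) * (c * (1 - b ^ 2) * X) = l * b → b = 0 → c = 0 := by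
    intro c b hb e1 h
    subst h
    simpa [hX.ne'] using e1
  -- Eliminating `c = l b / (X q²)` with `q = 1 - b²` gives `X q³ + l² q = 2 l²`, whose left side is
  -- strictly increasing in `q ≥ 0`; hence `b²` is determined by `l`.
  have main : ∀ c b : ℝ, b ^ 2 < 1 → (1 - b ^ 2) * (c * (1 - b ^ 2) * X) = l * b →
      b * (1 - b ^ 2) + c * (-(2 * b * (1 - b ^ 2)) * (c * (1 - b ^ 2) * X)) =
        l * (c * (1 - b ^ 2)) → b ≠ 0 →
      X * (1 - b ^ 2) ^ 3 = l ^ 2 * (2 - (1 - b ^ 2)) := by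
    intro c b hb e1 e2 h
    have hq : (1 - b ^ 2) ≠ 0 := by linarith
    have e3 : b - 2 * b * c * (c * (1 - b ^ 2) * X) = l * c := by
      apply mul_left_cancel₀ hq; linarith
    have hc : c = l * b / (X * (1 - b ^ 2) ^ 2) := by
      rw [eq_div_iff (by positivity)]; linarith
    rw [hc] at e3
    field_simp at e3
    linarith
  by_cases hb0 : b = 0
  · exact absurd ⟨out c b hb e1 hb0, hb0⟩ h0
  by_cases hb0' : b' = 0
  · exact Or.inr (Or.inr ⟨out c' b' hb' e1' hb0', hb0'⟩)
  have m := main c b hb e1 e2 hb0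
  have m' := main c' b' hb' e1' e2' hb0'
  have hsq : b' ^ 2 = b ^ 2 := by
    have hmono : StrictMonoOn (fun q : ℝ => X * q ^ 3 + l ^ 2 * q) (Set.Ici 0) := by
      intro p hp q hq hpq
      have : p ^ 3 < q ^ 3 := pow_lt_pow_left₀ hpq hp (by norm_num)
      have h1 : X * p ^ 3 < X * q ^ 3 := by gcongr
      have h2 : l ^ 2 * p ≤ l ^ 2 * q := by gcongr
      simp only
      linarith
    have h1 : 1 - b' ^ 2 ∈ Set.Ici 0 := by rw [Set.mem_Ici]; linarith
    have h2 : 1 - b ^ 2 ∈ Set.Ici 0 := by rw [Set.mem_Ici]; linarith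
    have := hmono.injOn h1 h2 (by linarith)
    linarith
  have hq : (1 - b ^ 2) * ((1 - b ^ 2) * X) ≠ 0 := by
    have : 0 < 1 - b ^ 2 := by linarith
    positivity
  rw [hsq] at e1'
  rcases sq_eq_sq_iff_eq_or_eq_neg.1 hsq with h | h
  · refine Or.inl ⟨mul_left_cancel₀ hq ?_, h⟩
    rw [h] at e1'; linarith
  · refine Or.inr (Or.inl ⟨mul_left_cancel₀ hq ?_, h⟩)
    rw [h] at e1'; linarith

/-- The first equation gives `c X b (1-b)² = l`. Inserting it into the second leaves `c² X b (1-b) =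
1`, and squaring the first then eliminates `c`. -/
theorem sigmoid_unit {X l c b : ℝ} (hX : 0 < X) (hb : 0 < b) (hb' : b < 1)
    (e1 : b * (1 - b) * (c * (b * (1 - b)) * X) = l * b)
    (e2 : b * (b * (1 - b)) + c * ((1 - 2 * b) * (b * (1 - b)) * (c * (b * (1 - b)) * X)) =
      l * (c * (b * (1 - b)))) :
    c = l / (X * b * (1 - b) ^ 2) ∧ b * (1 - b) ^ 3 = l ^ 2 / X := by
  have hq : 0 < 1 - b := by linarith
  have hl : c * (X * b * (1 - b) ^ 2) = l := by
    apply mul_left_cancel₀ hb.ne'; linarith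
  have h1 : c ^ 2 * X * b * (1 - b) = 1 := by
    have hne : b * (b * (1 - b)) ≠ 0 := by positivity
    apply mul_left_cancel₀ hne
    rw [← hl] at e2
    linear_combination -e2
  refine ⟨by rw [eq_div_iff (by positivity), hl], ?_⟩
  rw [eq_div_iff hX.ne', ← hl]
  linear_combination (-(X * b * (1 - b) ^ 3)) * h1

end Activation

end LabelNoiseSGD

/-! ### Assembly of the theorem. -/

theorem mainTheorem4 {Ω : Type*} [MeasurableSpace Ω] (μ : Measure Ω) [IsProbabilityMeasure μ]
    (Z : ℕ → Ω → ℝ) (hZ : LabelNoiseSGD.IsLabelNoise μ Z)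
    (n d : ℕ) (x : EuclideanSpace ℝ (Fin d)) (hx : x ≠ 0) (y : ℝ)
    (σ : ℝ → ℝ) (hσ : σ = Real.tanh ∨ σ = Real.sigmoid)
    (θ : LabelNoiseSGD.Params n d)
    (hθ : LabelNoiseSGD.NonRepellent μ Z (LabelNoiseSGD.network σ x) y θ) :
    ∃ α₁ β₁ α₂ β₂ : ℝ,
      (∀ i : Fin n,
        (LabelNoiseSGD.Params.c θ i = α₁ ∧ LabelNoiseSGD.hidden σ x θ i = β₁) ∨
        (LabelNoiseSGD.Params.c θ i = α₂ ∧ LabelNoiseSGD.hidden σ x θ i = β₂) ∨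
        (LabelNoiseSGD.Params.c θ i = 0 ∧ LabelNoiseSGD.hidden σ x θ i = 0)) ∧
      (σ = Real.tanh → α₂ = -α₁ ∧ β₂ = -β₁) := by
  have hX : 0 < ‖x‖ ^ 2 := by have := norm_pos_iff.2 hx; positivity
  rcases hσ with rfl | rfl
  · have hd2 : ∀ u, HasDerivAt (fun u => 1 - Real.tanh u ^ 2)
        (-(2 * Real.tanh u * (1 - Real.tanh u ^ 2))) u := fun u => by
      refine (((LabelNoiseSGD.hasDerivAt_tanh u).pow 2).const_sub 1).congr_deriv ?_
      simp
    obtain ⟨l, hl⟩ := LabelNoiseSGD.NonRepellent.exists_fderiv_gradient_eq hZ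
      (LabelNoiseSGD.contDiff_network LabelNoiseSGD.contDiff_tanh x) hθ
    have hs := LabelNoiseSGD.stationarity_of_fderiv_gradient_eq LabelNoiseSGD.hasDerivAt_tanh hd2
      LabelNoiseSGD.contDiff_tanh hx hl
    by_cases hall : ∀ i, LabelNoiseSGD.Params.c θ i = 0 ∧
        LabelNoiseSGD.hidden Real.tanh x θ i = 0
    · exact ⟨0, 0, 0, 0, fun i => Or.inl (hall i), by simp⟩
    obtain ⟨k, hk⟩ := not_forall.1 hall
    -- Any unit that is not `(0, 0)` serves as reference; the two holes are filled by the negated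
    -- values through `rfl`.
    refine ⟨LabelNoiseSGD.Params.c θ k, LabelNoiseSGD.hidden Real.tanh x θ k, _, _, fun i => ?_,
      fun _ => ⟨rfl, rfl⟩⟩
    have hsk := hs k
    have hsi := hs i
    rw [← LabelNoiseSGD.hidden_eq Real.tanh] at hsk hsi
    exact LabelNoiseSGD.tanh_units_eq_or_neg hX (LabelNoiseSGD.tanh_sq_lt_one _)
      (LabelNoiseSGD.tanh_sq_lt_one _) hsk.1 hsk.2 hsi.1 hsi.2 hk
  · have hd2 : ∀ u, HasDerivAt (fun u => Real.sigmoid u * (1 - Real.sigmoid u))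
        ((1 - 2 * Real.sigmoid u) * (Real.sigmoid u * (1 - Real.sigmoid u))) u := fun u => by
      refine ((Real.hasDerivAt_sigmoid u).mul ((Real.hasDerivAt_sigmoid u).const_sub 1)).congr_deriv ?_
      ring
    have hsm : ContDiff ℝ (⊤ : ℕ∞) Real.sigmoid := contDiff_sigmoid.of_le le_top
    obtain ⟨l, hl⟩ := LabelNoiseSGD.NonRepellent.exists_fderiv_gradient_eq hZ
      (LabelNoiseSGD.contDiff_network hsm x) hθ
    have hs : ∀ i, LabelNoiseSGD.hidden Real.sigmoid x θ i < 1 ∧ _ := fun i => by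
      have h := LabelNoiseSGD.stationarity_of_fderiv_gradient_eq Real.hasDerivAt_sigmoid hd2 hsm
        hx hl i
      rw [← LabelNoiseSGD.hidden_eq Real.sigmoid] at h
      exact ⟨Real.sigmoid_lt_one _, LabelNoiseSGD.sigmoid_unit
        (b := LabelNoiseSGD.hidden Real.sigmoid x θ i) hX (Real.sigmoid_pos _)
        (Real.sigmoid_lt_one _) h.1 h.2⟩
    have hne : Real.sigmoid ≠ Real.tanh := fun h => by
      have := congrFun h 0
      simp [Real.sigmoid_zero] at this
    have hc : ∀ i j, LabelNoiseSGD.hidden Real.sigmoid x θ i =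
        LabelNoiseSGD.hidden Real.sigmoid x θ j →
        LabelNoiseSGD.Params.c θ i = LabelNoiseSGD.Params.c θ j := fun i j h => by
      rw [(hs i).2.1, (hs j).2.1, h]
    rcases isEmpty_or_nonempty (Fin n) with he | ⟨⟨k⟩⟩
    · exact ⟨0, 0, 0, 0, fun i => he.elim i, fun h => absurd h hne⟩
    -- If all units agree, the second pair is arbitrary. Otherwise two distinct values already
    -- exhaust the roots; the zero alternative never occurs, as the logistic function is positive.
    by_cases hall : ∀ i, LabelNoiseSGD.hidden Real.sigmoid x θ i =
        LabelNoiseSGD.hidden Real.sigmoid x θ k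
    · exact ⟨_, _, 0, 0, fun i => Or.inl ⟨hc i k (hall i), hall i⟩, fun h => absurd h hne⟩
    obtain ⟨m, hm⟩ := not_forall.1 hall
    refine ⟨LabelNoiseSGD.Params.c θ k, LabelNoiseSGD.hidden Real.sigmoid x θ k,
      LabelNoiseSGD.Params.c θ m, LabelNoiseSGD.hidden Real.sigmoid x θ m, fun i => ?_,
      fun h => absurd h hne⟩
    rcases LabelNoiseSGD.eq_or_eq_of_mul_one_sub_cube_eq (hs k).1 (hs m).1 (hs i).1 (hs k).2.2
      (hs m).2.2 (hs i).2.2 (Ne.symm hm) with h | h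
    · exact Or.inl ⟨hc i k h, h⟩
    · exact Or.inr (Or.inl ⟨hc i m h, h⟩)
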